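/- Let $S\subseteq\mathbb N^2$ be a local good semigroup, i.e. a submonoid of $(\mathbb N^2,+)$ such that (G1) the componentwise minimum $\alpha\wedge\beta$ of any $\alpha,\beta\in S$ is in $S$; (G2) if $\alpha,\beta\in S$ and $\alpha_i=\beta_i$ for some $i\in\{1,2\}$, then, with $j\neq i$, there is $\delta\in S$ with $\delta_i>\alpha_i=\beta_i$, $\delta_j\ge\min\{\alpha_j,\beta_j\}$, and $\delta_j=\min\{\alpha_j,\beta_j\}$ if $\alpha_j\ne\beta_j$; (G3) there is $c\in S$ with $c+\mathbb N^2\subseteq S$; and (locality) $(0,0)$ is the only element of $S$ with a zero component. Let $(e_1,e_2)$ be the smallest nonzero element of $S$ for the componentwise order, let $e=e_1+e_2$, let $S_1,S_2$ be the two projections of $S$, and let $\mathbf{Ap}(S)=\{\alpha\in S:\alpha-(e_1,e_2)\notin S\}$. For $\alpha,\beta\in\mathbb N^2$ write $\alpha\le\le\beta$ if $\alpha=\beta$ or ($\alpha_1<\beta_1$ and $\alpha_2<\beta_2$). For $i\ge 1$ define inductively: $B^{(i)}$ is the set of elements of $\mathbf{Ap}(S)\setminus\bigcup_{j<i}D^{(j)}$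 that are maximal in this set with respect to $\le\le$; $C^{(i)}$ is the set of $\alpha\in B^{(i)}$ with $\alpha=\beta_1\wedge\beta_2$ for some $\beta_1,\beta_2\in B^{(i)}\setminus\{\alpha\}$; and $D^{(i)}=B^{(i)}\setminus C^{(i)}$. Let $N$ be the least integer with $\mathbf{Ap}(S)=\bigcup_{i=1}^N D^{(i)}$, and let $A_i=D^{(N+1-i)}$ for $1\le i\le N$ (the levels of $\mathbf{Ap}(S)$). For $s_1\in S_1$ and $r\in S_2$ let $\Delta_1(s_1,r)=\{(s_1,y):y>r\}$, and for $q\in S_1$ and $s_2\in S_2$ let $\Delta_2(q,s_2)=\{(x,s_2):x>q\}$. We say that $A_i$ contains the vertical line at $s_1\in S_1$ if $\Delta_1(s_1,r)\subseteq A_i$ for some $r\in S_2$, and that $A_i$ contains the horizontal line at $s_2\in S_2$ if $\Delta_2(q,s_2)\subseteq A_i$ for some $q\in S_1$. (Lines that differ only in the starting point $r$, respectively $q$, are thus counted once.) Then $N=e$, so that $\mathbf{Ap}(S)=\bigcup_{i=1}^e A_i$, and, if $e_1\ge e_2$: (1) each of the levels $A_e,A_{e-1},\dots,A_{e-e_2+1}$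 contains exactly two infinite lines, namely exactly one vertical and exactly one horizontal line; (2) each of the levels $A_{e-e_2},\dots,A_{e-e_1+1}$ (no levels if $e_1=e_2$) contains exactly one vertical line and no horizontal line; (3) the levels $A_{e-e_1},\dots,A_2,A_1$ are finite. If $e_1\le e_2$, the analogous statements hold with the two components exchanged: each of $A_e,\dots,A_{e-e_1+1}$ contains exactly one vertical and exactly one horizontal line; each of $A_{e-e_1},\dots,A_{e-e_2+1}$ contains exactly one horizontal line and no vertical line; the levels $A_{e-e_2},\dots,A_1$ are finite. -/

import Mathlib

namespace GoodSemigroup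

/-- A submonoid of `ℕ²` is a good semigroup: it is closed under componentwise minima (G1),
satisfies the exchange property in each of the two components (G2), and contains a translate
of `ℕ²` (G3). The order on `ℕ × ℕ` is the componentwise one. -/
structure IsGood (S : AddSubmonoid (ℕ × ℕ)) : Prop where
  inf_mem : ∀ α ∈ S, ∀ β ∈ S, α ⊓ β ∈ S
  exchange_fst : ∀ α ∈ S, ∀ β ∈ S, α.1 = β.1 →
    ∃ δ ∈ S, α.1 < δ.1 ∧ min α.2 β.2 ≤ δ.2 ∧ (α.2 ≠ β.2 → δ.2 = min α.2 β.2)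
  exchange_snd : ∀ α ∈ S, ∀ β ∈ S, α.2 = β.2 →
    ∃ δ ∈ S, α.2 < δ.2 ∧ min α.1 β.1 ≤ δ.1 ∧ (α.1 ≠ β.1 → δ.1 = min α.1 β.1)
  exists_conductor : ∃ c ∈ S, ∀ x : ℕ × ℕ, c + x ∈ S

/-- `S` is local: `0` is its only element with a zero component. -/
def IsLocal (S : AddSubmonoid (ℕ × ℕ)) : Prop :=
  ∀ α ∈ S, α.1 = 0 ∨ α.2 = 0 → α = 0

/-- `e` is the smallest nonzero element of `S`. -/
def IsMinNonzero (S : AddSubmonoid (ℕ × ℕ)) (e : ℕ × ℕ) : Prop :=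
  IsLeast {α : ℕ × ℕ | α ∈ S ∧ α ≠ 0} e

/-- The Apéry set of `S` with respect to `β`: the elements `α ∈ S` with `α - β ∉ S`. -/
def apery (S : AddSubmonoid (ℕ × ℕ)) (β : ℕ × ℕ) : Set (ℕ × ℕ) :=
  {α | α ∈ S ∧ ¬ ∃ σ ∈ S, σ + β = α}

/-- The relation `≪`: strictly smaller in both components. -/
def Dominated (α β : ℕ × ℕ) : Prop := α.1 < β.1 ∧ α.2 < β.2

/-- The partial order `≤≤`: equal, or strictly smaller in both components. -/
def LeLe (α β : ℕ × ℕ) : Prop := α = β ∨ Dominated α β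

/-- The elements of `X` that are maximal in `X` with respect to `≤≤`. -/
def maxPart (X : Set (ℕ × ℕ)) : Set (ℕ × ℕ) :=
  {α | α ∈ X ∧ ∀ β ∈ X, LeLe α β → β = α}

/-- The elements of `B` that are the componentwise minimum of two other elements of `B`. -/
def infPart (B : Set (ℕ × ℕ)) : Set (ℕ × ℕ) :=
  {α | α ∈ B ∧ ∃ β₁ ∈ B \ {α}, ∃ β₂ ∈ B \ {α}, α = β₁ ⊓ β₂}

/-- With `B` the maximal part of `X` and `C` the part of `B` consisting of minima of two other
elements of `B`, the difference `B \ C`. -/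
def topLayer (X : Set (ℕ × ℕ)) : Set (ℕ × ℕ) :=
  maxPart X \ infPart (maxPart X)

/-- What is left of `X` after removing its first `n` layers. -/
def remaining (X : Set (ℕ × ℕ)) : ℕ → Set (ℕ × ℕ)
  | 0 => X
  | n + 1 => remaining X n \ topLayer (remaining X n)

/-- The layers of `X`, numbered from the top and starting at `0`: `layer X k` is the set usually
written `D^(k+1)`, the top layer of `X \ (D^(1) ∪ ⋯ ∪ D^(k))`. -/
def layer (X : Set (ℕ × ℕ)) (k : ℕ) : Set (ℕ × ℕ) := topLayer (remaining X k)

/-- The number `N` of levels: the least `N` for which the first `N` layers exhaust the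
Apéry set of `S` with respect to `e`. -/
noncomputable def numLevels (S : AddSubmonoid (ℕ × ℕ)) (e : ℕ × ℕ) : ℕ :=
  sInf {N : ℕ | apery S e = ⋃ k ∈ Set.Iio N, layer (apery S e) k}

/-- The level `A_i = D^(N+1-i)` of the Apéry set, for `1 ≤ i ≤ N`. -/
noncomputable def level (S : AddSubmonoid (ℕ × ℕ)) (e : ℕ × ℕ) (i : ℕ) : Set (ℕ × ℕ) :=
  layer (apery S e) (numLevels S e - i)

/-- The projection `S₁` of `S`. -/
def proj₁ (S : AddSubmonoid (ℕ × ℕ)) : Set ℕ := {a | ∃ α ∈ S, α.1 = a}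

/-- The projection `S₂` of `S`. -/
def proj₂ (S : AddSubmonoid (ℕ × ℕ)) : Set ℕ := {b | ∃ α ∈ S, α.2 = b}

/-- `Δ₁(α)`: the points vertically above `α`. -/
def Δ₁ (α : ℕ × ℕ) : Set (ℕ × ℕ) := {β | β.1 = α.1 ∧ α.2 < β.2}

/-- `Δ₂(α)`: the points horizontally to the right of `α`. -/
def Δ₂ (α : ℕ × ℕ) : Set (ℕ × ℕ) := {β | β.2 = α.2 ∧ α.1 < β.1}

/-- The element `s₁ ∈ S₁` gives an infinite vertical line `Δ₁(s₁, r)` of the Apéry set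
(for some `r ∈ S₂`) that is contained in `A`. -/
def VerticalLineIn (S : AddSubmonoid (ℕ × ℕ)) (e : ℕ × ℕ) (A : Set (ℕ × ℕ)) (s₁ : ℕ) : Prop :=
  s₁ ∈ proj₁ S ∧ ∃ r ∈ proj₂ S, Δ₁ (s₁, r) ⊆ apery S e ∧ Δ₁ (s₁, r) ⊆ A

/-- The element `s₂ ∈ S₂` gives an infinite horizontal line `Δ₂(q, s₂)` of the Apéry set
(for some `q ∈ S₁`) that is contained in `A`. -/
def HorizontalLineIn (S : AddSubmonoid (ℕ × ℕ)) (e : ℕ × ℕ) (A : Set (ℕ × ℕ)) (s₂ : ℕ) : Prop :=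
  s₂ ∈ proj₂ S ∧ ∃ q ∈ proj₁ S, Δ₂ (q, s₂) ⊆ apery S e ∧ Δ₂ (q, s₂) ⊆ A

/-- `A` contains two infinite lines, exactly one vertical and exactly one horizontal. -/
def HasTwoLines (S : AddSubmonoid (ℕ × ℕ)) (e : ℕ × ℕ) (A : Set (ℕ × ℕ)) : Prop :=
  (∃! s₁, VerticalLineIn S e A s₁) ∧ ∃! s₂, HorizontalLineIn S e A s₂

/-- `A` contains only one infinite line, and it is vertical. -/
def HasOnlyVerticalLine (S : AddSubmonoid (ℕ × ℕ)) (e : ℕ × ℕ) (A : Set (ℕ × ℕ)) : Prop :=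
  (∃! s₁, VerticalLineIn S e A s₁) ∧ ¬ ∃ s₂, HorizontalLineIn S e A s₂

/-- `A` contains only one infinite line, and it is horizontal. -/
def HasOnlyHorizontalLine (S : AddSubmonoid (ℕ × ℕ)) (e : ℕ × ℕ) (A : Set (ℕ × ℕ)) : Prop :=
  (∃! s₂, HorizontalLineIn S e A s₂) ∧ ¬ ∃ s₁, VerticalLineIn S e A s₁

end GoodSemigroup

/-! Put `T = S + (e₁, e₂)`, so that the Apéry set is `S \ T`, and let `d(x, y)` measure how much of
`S` is missing from `T` above `(x, y)`. A unit step to the right counts 1 when `S` meets the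
vertical half-line over the point being left and `T` does not; a unit step upwards is counted
likewise with horizontal half-lines. The exchange properties make the sum independent of the path
(`vStep_add_hStep`).

The layers are the level sets of this function: `D^(k+1)` consists of the points of `S \ T` with `d
= k + 1` (`mem_layer_iff`). Everything else is counting. Translation by `e₁` removes exactly `e₁`
residual columns and translation by `e₂` removes `e₂` rows (`sum_shift_eq`), so `d(0, 0) = e₁ + e₂`,
which is `N`. Beyond the conductor, `d` falls from `e₁` to 0 along the top edge and from `e₂` to 0
along the right edge, in unit jumps. Each jump is one infinite line, so each value `1, …, e₁`
carries one vertical line and each value `1, …, e₂` one horizontal line (`existsUnique_jump`).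
Larger values of `d` occur only in a bounded square. -/

namespace GoodSemigroup

/-- The properties shared by a good semigroup and its translates: closure under minima, the
exchange properties for distinct elements, and a conductor bounded by `(m, m)`. -/
structure GoodSet (T : Set (ℕ × ℕ)) (m : ℕ) : Prop where
  inf_mem : ∀ {a b c d : ℕ}, (a, b) ∈ T → (c, d) ∈ T → (min a c, min b d) ∈ T
  up : ∀ {x x' y : ℕ}, (x, y) ∈ T → (x', y) ∈ T → x < x' → ∃ y' > y, (x, y') ∈ T
  right : ∀ {x y y' : ℕ}, (x, y) ∈ T → (x, y') ∈ T → y < y' → ∃ x' > x, (x', y) ∈ T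
  cond : ∀ {x y : ℕ}, m ≤ x → m ≤ y → (x, y) ∈ T

/-- `T` has a point on the vertical half-line starting at `(x, y)`. -/
def Vert (T : Set (ℕ × ℕ)) (x y : ℕ) : Prop := ∃ y' ≥ y, (x, y') ∈ T

/-- `T` has a point on the horizontal half-line starting at `(x, y)`. -/
def Horz (T : Set (ℕ × ℕ)) (x y : ℕ) : Prop := ∃ x' ≥ x, (x', y) ∈ T

open Classical in
/-- The contribution of the step from `(x, y)` to `(x + 1, y)` to the distance between `S`
and `T`. -/
noncomputable def vStep (S T : Set (ℕ × ℕ)) (x y : ℕ) : ℕ :=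
  if Vert S x y ∧ ¬ Vert T x y then 1 else 0

open Classical in
/-- The contribution of the step from `(x, y)` to `(x, y + 1)` to the distance between `S`
and `T`. -/
noncomputable def hStep (S T : Set (ℕ × ℕ)) (x y : ℕ) : ℕ :=
  if Horz S x y ∧ ¬ Horz T x y then 1 else 0

/-- The distance between the parts of `S` and `T` above `(x, y)`, computed along the path from
`(x, y)` to `(M, M)` through `(M, y)`. -/
noncomputable def dist (S T : Set (ℕ × ℕ)) (M x y : ℕ) : ℕ :=
  ∑ i ∈ Finset.Ico x M, vStep S T i y + ∑ j ∈ Finset.Ico y M, hStep S T M j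

/-! ### Half-lines meeting a good set. -/

lemma Vert.of_succ {T : Set (ℕ × ℕ)} {x y : ℕ} (h : Vert T x (y + 1)) : Vert T x y := by
  obtain ⟨y', hy, h⟩ := h
  exact ⟨y', by omega, h⟩

lemma Horz.of_succ {T : Set (ℕ × ℕ)} {x y : ℕ} (h : Horz T (x + 1) y) : Horz T x y := by
  obtain ⟨x', hx, h⟩ := h
  exact ⟨x', by omega, h⟩

lemma Vert.mono {S T : Set (ℕ × ℕ)} (hTS : T ⊆ S) {x y : ℕ} (h : Vert T x y) : Vert S x y := by
  obtain ⟨y', hy, h⟩ := h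
  exact ⟨y', hy, hTS h⟩

lemma Horz.mono {S T : Set (ℕ × ℕ)} (hTS : T ⊆ S) {x y : ℕ} (h : Horz T x y) : Horz S x y := by
  obtain ⟨x', hx, h⟩ := h
  exact ⟨x', hx, hTS h⟩

lemma Vert.mem {T : Set (ℕ × ℕ)} {x y : ℕ} (h : Vert T x y) (h' : ¬ Vert T x (y + 1)) :
    (x, y) ∈ T := by
  obtain ⟨y', hy, h⟩ := h
  obtain rfl | hlt := hy.eq_or_lt
  · exact h
  · exact absurd ⟨y', hlt, h⟩ h'

lemma Horz.mem {T : Set (ℕ × ℕ)} {x y : ℕ} (h : Horz T x y) (h' : ¬ Horz T (x + 1) y) :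
    (x, y) ∈ T := by
  obtain ⟨x', hx, h⟩ := h
  obtain rfl | hlt := hx.eq_or_lt
  · exact h
  · exact absurd ⟨x', hlt, h⟩ h'

lemma vert_of_mem {T : Set (ℕ × ℕ)} {x y : ℕ} (h : (x, y) ∈ T) : Vert T x y := ⟨y, le_rfl, h⟩

lemma horz_of_mem {T : Set (ℕ × ℕ)} {x y : ℕ} (h : (x, y) ∈ T) : Horz T x y := ⟨x, le_rfl, h⟩

namespace GoodSet

variable {T : Set (ℕ × ℕ)} {m : ℕ}

lemma mem_of_vert_of_horz (hT : GoodSet T m) {x y : ℕ} (hv : Vert T x y) (hh : Horz T x y) :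
    (x, y) ∈ T := by
  obtain ⟨y', hy, hv⟩ := hv
  obtain ⟨x', hx, hh⟩ := hh
  simpa [min_eq_left hx, min_eq_right hy] using hT.inf_mem hv hh

lemma vert_of_le (hT : GoodSet T m) {x y : ℕ} (hx : m ≤ x) : Vert T x y :=
  ⟨max m y, le_max_right _ _, hT.cond hx (le_max_left _ _)⟩

lemma horz_of_le (hT : GoodSet T m) {x y : ℕ} (hy : m ≤ y) : Horz T x y :=
  ⟨max m x, le_max_right _ _, hT.cond (le_max_left _ _) hy⟩

/-- Here `(x, y)` is the highest point of its column, so by `up` no point of `T` can lie to its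
right. -/
lemma not_horz_succ (hT : GoodSet T m) {x y : ℕ} (h : Vert T x y) (h' : ¬ Vert T x (y + 1)) :
    ¬ Horz T (x + 1) y := by
  rintro ⟨x', hx, hx'⟩
  obtain ⟨y', hy, hy'⟩ := hT.up (h.mem h') hx' hx
  exact h' ⟨y', hy, hy'⟩

lemma not_vert_succ (hT : GoodSet T m) {x y : ℕ} (h : Horz T x y) (h' : ¬ Horz T (x + 1) y) :
    ¬ Vert T x (y + 1) := by
  rintro ⟨y', hy, hy'⟩
  obtain ⟨x', hx, hx'⟩ := hT.right (h.mem h') hy' hy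
  exact h' ⟨x', hx, hx'⟩

/-- A column ending at height `z ≥ m` would, by `not_horz_succ`, leave row `z` empty to its right,
but that row reaches into the conductor. -/
lemma vert_iff_of_le (hT : GoodSet T m) {x y z : ℕ} (hy : m ≤ y) (hz : y ≤ z) :
    Vert T x y ↔ Vert T x z := by
  induction z, hz using Nat.le_induction with
  | base => rfl
  | succ z hz ih =>
    rw [ih]
    refine ⟨fun h => ?_, Vert.of_succ⟩
    by_contra h'
    exact hT.not_horz_succ h h' (hT.horz_of_le (hy.trans hz))

lemma horz_iff_of_le (hT : GoodSet T m) {x y z : ℕ} (hx : m ≤ x) (hz : x ≤ z) :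
    Horz T x y ↔ Horz T z y := by
  induction z, hz using Nat.le_induction with
  | base => rfl
  | succ z hz ih =>
    rw [ih]
    refine ⟨fun h => ?_, Horz.of_succ⟩
    by_contra h'
    exact hT.not_vert_succ h h' (hT.vert_of_le (hx.trans hz))

end GoodSet

lemma vStep_eq_one {S T : Set (ℕ × ℕ)} {x y : ℕ} :
    vStep S T x y = 1 ↔ Vert S x y ∧ ¬ Vert T x y := by
  unfold vStep; split_ifs <;> simp_all

lemma hStep_eq_one {S T : Set (ℕ × ℕ)} {x y : ℕ} :
    hStep S T x y = 1 ↔ Horz S x y ∧ ¬ Horz T x y := by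
  unfold hStep; split_ifs <;> simp_all

lemma vStep_le_one (S T : Set (ℕ × ℕ)) (x y : ℕ) : vStep S T x y ≤ 1 := by
  unfold vStep; split_ifs <;> simp

lemma hStep_le_one (S T : Set (ℕ × ℕ)) (x y : ℕ) : hStep S T x y ≤ 1 := by
  unfold hStep; split_ifs <;> simp

/-! ### The distance function and its path independence. -/

/-- Two subsets `T ⊆ S` of `ℕ²` to which the theory of the distance function applies. -/
structure GoodPair (S T : Set (ℕ × ℕ)) (M : ℕ) : Prop where
  left : GoodSet S M
  right : GoodSet T M
  sub : T ⊆ S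

namespace GoodPair

variable {S T : Set (ℕ × ℕ)} {M : ℕ}

lemma vStep_eq_zero (h : GoodPair S T M) {x y : ℕ} (hx : M ≤ x) : vStep S T x y = 0 := by
  simp [vStep, h.right.vert_of_le hx]

lemma hStep_eq_zero (h : GoodPair S T M) {x y : ℕ} (hy : M ≤ y) : hStep S T x y = 0 := by
  simp [hStep, h.right.horz_of_le hy]

/-- In one good set, a point is the top of its column exactly when it is the right end of its row.
Hence the indicators of `Vert` and `Horz` satisfy this identity for `S` and for `T` separately;
since `T ⊆ S`, the steps are the differences of those indicators. -/
lemma vStep_add_hStep (h : GoodPair S T M) (x y : ℕ) :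
    vStep S T x y + hStep S T (x + 1) y = hStep S T x y + vStep S T x (y + 1) := by
  have key : ∀ {U : Set (ℕ × ℕ)}, GoodSet U M →
      (Vert U x (y + 1) → Vert U x y) ∧ (Horz U (x + 1) y → Horz U x y) ∧
      (Vert U x y ∧ ¬ Vert U x (y + 1) ↔ Horz U x y ∧ ¬ Horz U (x + 1) y) := fun hU =>
    ⟨Vert.of_succ, Horz.of_succ,
      fun ⟨h₁, h₂⟩ => ⟨horz_of_mem (h₁.mem h₂), hU.not_horz_succ h₁ h₂⟩,
      fun ⟨h₁, h₂⟩ => ⟨vert_of_mem (h₁.mem h₂), hU.not_vert_succ h₁ h₂⟩⟩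
  have hS := key h.left
  have hT := key h.right
  have h₁ : Vert T x y → Vert S x y := Vert.mono h.sub
  have h₂ : Horz T x y → Horz S x y := Horz.mono h.sub
  have h₃ : Vert T x (y + 1) → Vert S x (y + 1) := Vert.mono h.sub
  have h₄ : Horz T (x + 1) y → Horz S (x + 1) y := Horz.mono h.sub
  unfold vStep hStep
  grind

lemma dist_eq_vStep_add (h : GoodPair S T M) (x y : ℕ) :
    dist S T M x y = vStep S T x y + dist S T M (x + 1) y := by
  unfold dist
  rcases lt_or_ge x M with hx | hx
  · rw [Finset.sum_eq_sum_Ico_succ_bot hx, add_assoc]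
  · rw [h.vStep_eq_zero hx, Finset.Ico_eq_empty_of_le hx,
      Finset.Ico_eq_empty_of_le (Nat.le_succ_of_le hx), zero_add]

lemma hStep_eq_of_le (h : GoodPair S T M) {x : ℕ} (hx : M ≤ x) (y : ℕ) :
    hStep S T M y = hStep S T x y := by
  unfold hStep
  rw [h.left.horz_iff_of_le le_rfl hx, h.right.horz_iff_of_le le_rfl hx]

lemma vStep_eq_of_le (h : GoodPair S T M) {y : ℕ} (hy : M ≤ y) (x : ℕ) :
    vStep S T x M = vStep S T x y := by
  unfold vStep
  rw [h.left.vert_iff_of_le le_rfl hy, h.right.vert_iff_of_le le_rfl hy]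

lemma dist_eq_hStep_add_of_le (h : GoodPair S T M) {x : ℕ} (hx : M ≤ x) (y : ℕ) :
    dist S T M x y = hStep S T x y + dist S T M x (y + 1) := by
  unfold dist
  rw [Finset.Ico_eq_empty (a := x) (by omega), Finset.sum_empty, Finset.sum_empty, zero_add,
    zero_add, ← h.hStep_eq_of_le hx]
  rcases lt_or_ge y M with hy | hy
  · rw [Finset.sum_eq_sum_Ico_succ_bot hy]
  · rw [h.hStep_eq_zero hy, Finset.Ico_eq_empty_of_le hy,
      Finset.Ico_eq_empty_of_le (Nat.le_succ_of_le hy), zero_add]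

lemma dist_eq_hStep_add (h : GoodPair S T M) (x y : ℕ) :
    dist S T M x y = hStep S T x y + dist S T M x (y + 1) := by
  rcases le_total M x with hx | hx
  · exact h.dist_eq_hStep_add_of_le hx y
  -- The identity is carried leftwards from column `M`, one unit square at a time.
  · induction hx using Nat.decreasingInduction with
    | self => exact h.dist_eq_hStep_add_of_le le_rfl y
    | of_succ x hx ih =>
      have h₁ := h.dist_eq_vStep_add x y
      have h₂ := h.dist_eq_vStep_add x (y + 1)
      have h₃ := h.vStep_add_hStep x y
      omega

lemma dist_anti (h : GoodPair S T M) {x y x' y' : ℕ} (hx : x ≤ x') (hy : y ≤ y') :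
    dist S T M x' y' ≤ dist S T M x y := by
  have h₁ : Antitone fun x => dist S T M x y' :=
    antitone_nat_of_succ_le fun x => by rw [h.dist_eq_vStep_add x]; omega
  have h₂ : Antitone fun y => dist S T M x y :=
    antitone_nat_of_succ_le fun y => by rw [h.dist_eq_hStep_add x y]; omega
  exact (h₁ hx).trans (h₂ hy)

lemma dist_eq_zero {x y : ℕ} (hx : M ≤ x) (hy : M ≤ y) : dist S T M x y = 0 := by
  simp [dist, Finset.Ico_eq_empty_of_le hx, Finset.Ico_eq_empty_of_le hy]

lemma dist_eq_of_le_left {x y : ℕ} (hx : M ≤ x) :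
    dist S T M x y = dist S T M M y := by
  simp [dist, Finset.Ico_eq_empty_of_le hx]

lemma dist_eq_of_le_right (h : GoodPair S T M) {x y : ℕ} (hy : M ≤ y) :
    dist S T M x y = dist S T M x M := by
  simp [dist, Finset.Ico_eq_empty_of_le hy, h.vStep_eq_of_le hy]

lemma mem_of_steps (h : GoodPair S T M) {x y : ℕ} (hv : vStep S T x y = 1)
    (hh : hStep S T x y = 1) : (x, y) ∈ S \ T := by
  rw [vStep_eq_one] at hv
  rw [hStep_eq_one] at hh
  exact ⟨h.left.mem_of_vert_of_horz hv.1 hh.1, fun hm => hv.2 (vert_of_mem hm)⟩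

/-- If both steps vanished, `T` would meet both half-lines from the point and, being closed under
minima, contain it. -/
lemma steps_of_mem (h : GoodPair S T M) {x y : ℕ} (hm : (x, y) ∈ S \ T) :
    vStep S T x y = 1 ∨ hStep S T x y = 1 := by
  rw [vStep_eq_one, hStep_eq_one]
  by_contra! hc
  exact hm.2 (h.right.mem_of_vert_of_horz (hc.1 (vert_of_mem hm.1)) (hc.2 (horz_of_mem hm.1)))

lemma hStep_eq_one_iff (h : GoodPair S T M) {x y : ℕ} (hx : M ≤ x) :
    hStep S T M y = 1 ↔ (x, y) ∈ S \ T := by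
  rw [h.hStep_eq_of_le hx]
  refine ⟨fun hh => ?_, fun hm => ?_⟩
  · rw [hStep_eq_one] at hh
    exact ⟨h.left.mem_of_vert_of_horz (h.left.vert_of_le hx) hh.1, fun hm => hh.2 (horz_of_mem hm)⟩
  · simpa [h.vStep_eq_zero hx] using h.steps_of_mem hm

lemma vStep_eq_one_iff (h : GoodPair S T M) {x y : ℕ} (hy : M ≤ y) :
    vStep S T x M = 1 ↔ (x, y) ∈ S \ T := by
  rw [h.vStep_eq_of_le hy]
  refine ⟨fun hh => ?_, fun hm => ?_⟩
  · rw [vStep_eq_one] at hh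
    exact ⟨h.left.mem_of_vert_of_horz hh.1 (h.left.horz_of_le hy), fun hm => hh.2 (vert_of_mem hm)⟩
  · simpa [h.hStep_eq_zero hy] using h.steps_of_mem hm

lemma dist_pos (h : GoodPair S T M) {x y : ℕ} (hm : (x, y) ∈ S \ T) : 1 ≤ dist S T M x y := by
  rcases h.steps_of_mem hm with hs | hs
  · rw [h.dist_eq_vStep_add]; omega
  · rw [h.dist_eq_hStep_add]; omega

/-- Every value of the distance function is attained at a point of `S \ T` further up. -/
lemma exists_mem_dist_eq (h : GoodPair S T M) {x y : ℕ} (hd : 1 ≤ dist S T M x y) :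
    ∃ x' y', x ≤ x' ∧ y ≤ y' ∧ (x', y') ∈ S \ T ∧ dist S T M x' y' = dist S T M x y := by
  obtain ⟨n, hn⟩ : ∃ n, (M - x) + (M - y) = n := ⟨_, rfl⟩
  induction n using Nat.strong_induction_on generalizing x y with
  | _ n ih =>
    have hv := h.dist_eq_vStep_add x y
    have hh := h.dist_eq_hStep_add x y
    have hv₁ := vStep_le_one S T x y
    have hh₁ := hStep_le_one S T x y
    -- Steps of length 0 preserve the distance. When none is left, either both steps are 1 or one
    -- coordinate is past `M` and the other step alone decides membership.
    by_cases hv₀ : vStep S T x y = 0 ∧ x < M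
    · obtain ⟨x', y', h₁, h₂, h₃, h₄⟩ := ih _ (by omega) (x := x + 1) (y := y) (by omega) rfl
      exact ⟨x', y', by omega, h₂, h₃, by omega⟩
    by_cases hh₀ : hStep S T x y = 0 ∧ y < M
    · obtain ⟨x', y', h₁, h₂, h₃, h₄⟩ := ih _ (by omega) (x := x) (y := y + 1) (by omega) rfl
      exact ⟨x', y', by omega, by omega, h₃, by omega⟩
    refine ⟨x, y, le_rfl, le_rfl, ?_, rfl⟩
    rcases lt_or_ge x M with hx | hx <;> rcases lt_or_ge y M with hy | hy
    · exact h.mem_of_steps (by omega) (by omega)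
    · rw [← h.vStep_eq_one_iff hy, h.vStep_eq_of_le hy]; omega
    · rw [← h.hStep_eq_one_iff hx, h.hStep_eq_of_le hx]; omega
    · rw [dist_eq_zero hx hy] at hd; omega

/-- One step up costs at most 1, and the remaining distance is attained further up or to the right.
-/
lemma exists_above_or_dominating (h : GoodPair S T M) {x y : ℕ} (hd : 2 ≤ dist S T M x y) :
    ∃ x' y', x ≤ x' ∧ y < y' ∧ (x', y') ∈ S \ T ∧ dist S T M x y ≤ dist S T M x' y' + 1 := by
  have hh := h.dist_eq_hStep_add x y
  have hh₁ := hStep_le_one S T x y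
  obtain ⟨x', y', h₁, h₂, h₃, h₄⟩ := h.exists_mem_dist_eq (x := x) (y := y + 1) (by omega)
  exact ⟨x', y', h₁, h₂, h₃, by omega⟩

lemma exists_right_or_dominating (h : GoodPair S T M) {x y : ℕ} (hd : 2 ≤ dist S T M x y) :
    ∃ x' y', x < x' ∧ y ≤ y' ∧ (x', y') ∈ S \ T ∧ dist S T M x y ≤ dist S T M x' y' + 1 := by
  have hv := h.dist_eq_vStep_add x y
  have hv₁ := vStep_le_one S T x y
  obtain ⟨x', y', h₁, h₂, h₃, h₄⟩ := h.exists_mem_dist_eq (x := x + 1) (y := y) (by omega)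
  exact ⟨x', y', h₁, h₂, h₃, by omega⟩

end GoodPair

/-! ### Layers as level sets of the distance. -/

/-- A maximal element is the minimum of two others exactly when the set has a point straight above
it and one straight to its right. -/
lemma mem_topLayer_iff {X : Set (ℕ × ℕ)} {α : ℕ × ℕ} :
    α ∈ topLayer X ↔ α ∈ X ∧ (∀ β ∈ X, ¬ Dominated α β) ∧
      ((∀ β ∈ X, β ∉ Δ₁ α) ∨ ∀ β ∈ X, β ∉ Δ₂ α) := by
  have hmax : ∀ β, β ∈ maxPart X ↔ β ∈ X ∧ ∀ γ ∈ X, ¬ Dominated β γ := fun β => by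
    refine and_congr_right fun _ => forall₂_congr fun γ _ => ?_
    refine ⟨fun h hd => ?_, fun h hd => ?_⟩
    · have := h (Or.inr hd)
      subst this
      exact lt_irrefl _ hd.1
    · exact (hd.resolve_right h).symm
  unfold topLayer infPart
  simp only [Set.mem_sdiff, Set.mem_ofPred_eq, Set.mem_singleton_iff, hmax]
  obtain ⟨a, b⟩ := α
  constructor
  · rintro ⟨⟨hX, hd⟩, hi⟩
    refine ⟨hX, hd, ?_⟩
    by_contra! hc
    obtain ⟨⟨⟨c, d⟩, hβ, h₁, h₁'⟩, ⟨c', d'⟩, hγ, h₂, h₂'⟩ := hc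
    simp only at h₁ h₁' h₂ h₂'
    subst h₁ h₂
    refine hi ⟨⟨hX, hd⟩, (c, d), ⟨⟨hβ, fun δ hδ hdom => hd δ hδ ⟨hdom.1, h₁'.trans hdom.2⟩⟩, ?_⟩,
      (c', d'), ⟨⟨hγ, fun δ hδ hdom => hd δ hδ ⟨h₂'.trans hdom.1, hdom.2⟩⟩, ?_⟩, ?_⟩
    · simp; omega
    · simp; omega
    · simp [h₁'.le, h₂'.le]
  · rintro ⟨hX, hd, hΔ⟩
    refine ⟨⟨hX, hd⟩, ?_⟩
    rintro ⟨-, ⟨c, d⟩, ⟨⟨hβ, -⟩, hne⟩, ⟨c', d'⟩, ⟨⟨hγ, -⟩, hne'⟩, heq⟩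
    have h₁ := hd _ hβ
    have h₂ := hd _ hγ
    simp only [Dominated, Prod.mk_inf_mk, Prod.mk.injEq, not_and, not_lt] at heq h₁ h₂ hne hne'
    have key : (c = a ∧ b < d ∧ d' = b ∧ a < c') ∨ (c' = a ∧ b < d' ∧ d = b ∧ a < c) := by omega
    simp only [Δ₁, Δ₂, Set.mem_ofPred_eq] at hΔ
    rcases key with ⟨k₁, k₂, k₃, k₄⟩ | ⟨k₁, k₂, k₃, k₄⟩ <;> rcases hΔ with hΔ | hΔ
    · exact hΔ _ hβ ⟨k₁, k₂⟩
    · exact hΔ _ hγ ⟨k₃, k₄⟩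
    · exact hΔ _ hγ ⟨k₁, k₂⟩
    · exact hΔ _ hβ ⟨k₃, k₄⟩

namespace GoodPair

variable {S T : Set (ℕ × ℕ)} {M : ℕ}

lemma mem_remaining_iff (h : GoodPair S T M) (k : ℕ) (α : ℕ × ℕ) :
    α ∈ remaining (S \ T) k ↔ α ∈ S \ T ∧ k + 1 ≤ dist S T M α.1 α.2 := by
  induction k generalizing α with
  | zero => exact ⟨fun hm => ⟨hm, h.dist_pos hm⟩, fun hm => hm.1⟩
  | succ k ih =>
    obtain ⟨x, y⟩ := α
    rw [remaining, Set.mem_sdiff, mem_topLayer_iff, ih]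
    constructor
    · rintro ⟨⟨hm, hd⟩, hn⟩
      refine ⟨hm, ?_⟩
      by_contra hlt
      have hv := h.dist_eq_vStep_add x y
      have hh := h.dist_eq_hStep_add x y
      -- Here the distance is exactly `k + 1`, and one of the two steps lowers it to `k`. No
      -- remaining point lies beyond that step, which excludes domination and one of the two
      -- half-lines.
      refine hn ⟨⟨hm, hd⟩, fun β hβ hdom => ?_, ?_⟩
      · have h₁ := h.dist_anti (x := x + 1) (y := y) hdom.1 hdom.2.le
        have h₂ := h.dist_anti (x := x) (y := y + 1) hdom.1.le hdom.2
        have h₃ := ((ih β).1 hβ).2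
        rcases h.steps_of_mem hm with hs | hs <;> simp only at * <;> omega
      · rcases h.steps_of_mem hm with hs | hs
        · refine Or.inr fun β hβ hΔ => ?_
          have h₁ := h.dist_anti (x := x + 1) (y := y) hΔ.2 hΔ.1.ge
          have h₃ := ((ih β).1 hβ).2
          simp only at *; omega
        · refine Or.inl fun β hβ hΔ => ?_
          have h₁ := h.dist_anti (x := x) (y := y + 1) hΔ.1.ge hΔ.2
          have h₃ := ((ih β).1 hβ).2
          simp only at *; omega
    · rintro ⟨hm, hd⟩
      refine ⟨⟨hm, by omega⟩, ?_⟩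
      rintro ⟨-, hdom, hΔ⟩
      simp only at hd
      -- With distance at least `k + 2`, remaining points exist in both directions; as none
      -- dominates, they lie on the two half-lines.
      obtain ⟨x₁, y₁, h₁, h₂, h₃, h₄⟩ := h.exists_above_or_dominating (x := x) (y := y) (by omega)
      obtain ⟨x₂, y₂, k₁, k₂, k₃, k₄⟩ := h.exists_right_or_dominating (x := x) (y := y) (by omega)
      have m₁ := (ih (x₁, y₁)).2 ⟨h₃, by simp only; omega⟩
      have m₂ := (ih (x₂, y₂)).2 ⟨k₃, by simp only; omega⟩
      have e₁ : x₁ = x := by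
        by_contra hne
        exact hdom _ m₁ ⟨by simp only; omega, h₂⟩
      have e₂ : y₂ = y := by
        by_contra hne
        exact hdom _ m₂ ⟨k₁, by simp only; omega⟩
      rcases hΔ with hΔ | hΔ
      · exact hΔ _ m₁ ⟨e₁, h₂⟩
      · exact hΔ _ m₂ ⟨e₂, k₁⟩

lemma mem_layer_iff (h : GoodPair S T M) (k : ℕ) (α : ℕ × ℕ) :
    α ∈ layer (S \ T) k ↔ α ∈ S \ T ∧ dist S T M α.1 α.2 = k + 1 := by
  have hsub : topLayer (remaining (S \ T) k) ⊆ remaining (S \ T) k := fun β hβ => hβ.1.1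
  have h₁ := h.mem_remaining_iff k α
  have h₂ := h.mem_remaining_iff (k + 1) α
  rw [remaining, Set.mem_sdiff] at h₂
  have h₃ := @hsub α
  rw [layer]
  have heq : dist S T M α.1 α.2 = k + 1 ↔
      k + 1 ≤ dist S T M α.1 α.2 ∧ ¬ k + 1 + 1 ≤ dist S T M α.1 α.2 := by omega
  rw [heq]
  tauto

end GoodPair

/-! ### Counting jumps and translated sets. -/

/-- A function decreasing from `n` to `0` in unit steps takes each value `k + 1 ≤ n` right before
exactly one of its jumps. -/
lemma existsUnique_jump {f s : ℕ → ℕ} {n M : ℕ} (hf : ∀ x, f x = s x + f (x + 1))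
    (hs : ∀ x, s x ≤ 1) (h₀ : f 0 = n) (hM : f M = 0) {k : ℕ} (hk : k < n) :
    ∃! x, s x = 1 ∧ f x = k + 1 := by
  have anti : Antitone f := antitone_nat_of_succ_le fun x => by have := hf x; omega
  have hex : ∃ x, f x ≤ k := ⟨M, by omega⟩
  have hspec := Nat.find_spec hex
  obtain ⟨x, hx⟩ : ∃ x, Nat.find hex = x + 1 := by
    refine Nat.exists_eq_succ_of_ne_zero fun h => ?_
    rw [h] at hspec
    omega
  rw [hx] at hspec
  have hmin := Nat.find_min hex (m := x) (by omega)
  have h₁ := hf x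
  have h₂ := hs x
  refine ⟨x, ⟨by omega, by omega⟩, ?_⟩
  rintro z ⟨hz₁, hz₂⟩
  have h₃ := hf z
  rcases lt_trichotomy z x with hlt | rfl | hlt
  · have := anti hlt; simp only [Nat.succ_eq_add_one] at this; omega
  · rfl
  · have := anti hlt; simp only [Nat.succ_eq_add_one] at this; omega

open Classical in
/-- The number of elements of `P` that do not lie in its translate by `e`, for a cofinite set `P`
of natural numbers mapped into itself by this translation. -/
lemma sum_shift_eq {P Q : ℕ → Prop} {e m : ℕ} {s : ℕ → ℕ}
    (hP : ∀ x ≥ m, P x) (hPe : ∀ x, P x → P (x + e)) (hQ : ∀ x, Q x ↔ ∃ z, P z ∧ z + e = x)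
    (hs : ∀ x, s x = if P x ∧ ¬ Q x then 1 else 0) {M : ℕ} (hM : m + e ≤ M) :
    ∑ x ∈ Finset.range M, s x = e := by
  have hzero : ∀ n ≤ e, ∑ x ∈ Finset.range n, s x = ∑ x ∈ Finset.range n, if P x then 1 else 0 := by
    intro n hn
    refine Finset.sum_congr rfl fun x hx => ?_
    rw [Finset.mem_range] at hx
    rw [hs, hQ]
    have : ¬ ∃ z, P z ∧ z + e = x := by rintro ⟨z, -, hz⟩; omega
    simp [this]
  -- Below `n + e`, the set `P` splits into `P \ Q` and the translate of the part of `P` below `n`.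
  have key : ∀ n, ∑ x ∈ Finset.range (n + e), s x + ∑ x ∈ Finset.range n, (if P x then 1 else 0)
      = ∑ x ∈ Finset.range (n + e), if P x then 1 else 0 := by
    intro n
    induction n with
    | zero => simpa using hzero e le_rfl
    | succ n ih =>
      have hQn : Q (n + e) ↔ P n := by
        rw [hQ]
        exact ⟨fun ⟨z, hz, hze⟩ => by rwa [← Nat.add_right_cancel hze], fun h => ⟨n, h, rfl⟩⟩
      have hn := hPe n
      rw [add_right_comm, Finset.sum_range_succ, Finset.sum_range_succ _ n,
        Finset.sum_range_succ _ (n + e), ← ih, hs (n + e), hQn]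
      by_cases h₁ : P n
      · simp [h₁, hn h₁]; ring
      · simp [h₁]; ring
  obtain ⟨n, rfl⟩ : ∃ n, M = n + e := ⟨M - e, by omega⟩
  have h₁ := key n
  have h₂ : ∑ x ∈ Finset.range (n + e), (if P x then 1 else 0)
      = ∑ x ∈ Finset.range n, (if P x then 1 else 0) + e := by
    rw [Finset.sum_range_add]
    simp [fun i => hP (n + i) (by omega)]
  omega

/-- The translate of `S` by `ε`. -/
def translate (S : AddSubmonoid (ℕ × ℕ)) (ε : ℕ × ℕ) : Set (ℕ × ℕ) := {α | ∃ σ ∈ S, σ + ε = α}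

lemma apery_eq (S : AddSubmonoid (ℕ × ℕ)) (ε : ℕ × ℕ) :
    apery S ε = (S : Set (ℕ × ℕ)) \ translate S ε := rfl

lemma IsGood.exists_goodSet {S : AddSubmonoid (ℕ × ℕ)} (hS : IsGood S) :
    ∃ m, GoodSet (S : Set (ℕ × ℕ)) m := by
  obtain ⟨⟨c, d⟩, -, hc⟩ := hS.exists_conductor
  refine ⟨c + d, fun h₁ h₂ => hS.inf_mem _ h₁ _ h₂, fun {x x' y} h₁ h₂ hlt => ?_,
    fun {x y y'} h₁ h₂ hlt => ?_, fun {x y} hx hy => ?_⟩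
  · obtain ⟨⟨u, v⟩, hδ, h₃, -, h₄⟩ := hS.exchange_snd _ h₁ _ h₂ rfl
    have : u = x := by simpa [min_eq_left hlt.le] using h₄ hlt.ne
    exact ⟨v, h₃, this ▸ hδ⟩
  · obtain ⟨⟨u, v⟩, hδ, h₃, -, h₄⟩ := hS.exchange_fst _ h₁ _ h₂ rfl
    have : v = y := by simpa [min_eq_left hlt.le] using h₄ hlt.ne
    exact ⟨u, h₃, this ▸ hδ⟩
  · have := hc (x - c, y - d)
    rwa [Prod.mk_add_mk, Nat.add_sub_of_le (by omega), Nat.add_sub_of_le (by omega)] at this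

lemma mem_translate_iff {S : AddSubmonoid (ℕ × ℕ)} {a b x y : ℕ} :
    (x, y) ∈ translate S (a, b) ↔ ∃ u v, (u, v) ∈ S ∧ u + a = x ∧ v + b = y := by
  simp [translate]

section Translate

variable {S : AddSubmonoid (ℕ × ℕ)} {a b m : ℕ}

lemma GoodSet.translate (hS : GoodSet (S : Set (ℕ × ℕ)) m) :
    GoodSet (translate S (a, b)) (m + a + b) := by
  refine ⟨fun h₁ h₂ => ?_, fun h₁ h₂ hlt => ?_, fun h₁ h₂ hlt => ?_, fun {x y} hx hy => ?_⟩
  · rw [mem_translate_iff] at *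
    obtain ⟨u, v, h₁, rfl, rfl⟩ := h₁
    obtain ⟨u', v', h₂, rfl, rfl⟩ := h₂
    exact ⟨_, _, hS.inf_mem h₁ h₂, by omega, by omega⟩
  · simp only [mem_translate_iff] at *
    obtain ⟨u, v, h₁, rfl, rfl⟩ := h₁
    obtain ⟨u', v', h₂, rfl, hv⟩ := h₂
    obtain rfl : v' = v := by omega
    obtain ⟨w, hw, h₃⟩ := hS.up h₁ h₂ (by omega)
    exact ⟨w + b, by omega, _, _, h₃, rfl, rfl⟩
  · simp only [mem_translate_iff] at *
    obtain ⟨u, v, h₁, rfl, rfl⟩ := h₁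
    obtain ⟨u', v', h₂, hu, rfl⟩ := h₂
    obtain rfl : u' = u := by omega
    obtain ⟨w, hw, h₃⟩ := hS.right h₁ h₂ (by omega)
    exact ⟨w + a, by omega, _, _, h₃, rfl, rfl⟩
  · rw [mem_translate_iff]
    exact ⟨x - a, y - b, hS.cond (by omega) (by omega), by omega, by omega⟩

lemma GoodSet.goodPair (hS : GoodSet (S : Set (ℕ × ℕ)) m) (hab : (a, b) ∈ S) :
    GoodPair (S : Set (ℕ × ℕ)) (GoodSemigroup.translate S (a, b)) (m + a + b) where
  left := ⟨hS.inf_mem, hS.up, hS.right, fun hx hy => hS.cond (by omega) (by omega)⟩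
  right := hS.translate
  sub := by
    rintro _ ⟨σ, hσ, rfl⟩
    exact S.add_mem hσ hab

lemma vert_add (hab : (a, b) ∈ S) {x y : ℕ} (h : Vert (S : Set (ℕ × ℕ)) x y) :
    Vert (S : Set (ℕ × ℕ)) (x + a) y := by
  obtain ⟨y', hy, h⟩ := h
  exact ⟨y' + b, by omega, S.add_mem h hab⟩

lemma horz_add (hab : (a, b) ∈ S) {x y : ℕ} (h : Horz (S : Set (ℕ × ℕ)) x y) :
    Horz (S : Set (ℕ × ℕ)) x (y + b) := by
  obtain ⟨x', hx, h⟩ := h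
  exact ⟨x' + a, by omega, S.add_mem h hab⟩

lemma vert_translate_iff {x y : ℕ} :
    Vert (translate S (a, b)) x y ↔ ∃ z, Vert (S : Set (ℕ × ℕ)) z (y - b) ∧ z + a = x := by
  simp only [Vert, mem_translate_iff]
  constructor
  · rintro ⟨_, hy, u, v, h, rfl, rfl⟩
    exact ⟨u, ⟨v, by omega, h⟩, rfl⟩
  · rintro ⟨z, ⟨v, hv, h⟩, rfl⟩
    exact ⟨v + b, by omega, z, v, h, rfl, rfl⟩

lemma horz_translate_iff {x y : ℕ} :
    Horz (translate S (a, b)) x y ↔ ∃ z, Horz (S : Set (ℕ × ℕ)) (x - a) z ∧ z + b = y := by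
  simp only [Horz, mem_translate_iff]
  constructor
  · rintro ⟨_, hx, u, v, h, rfl, rfl⟩
    exact ⟨v, ⟨u, by omega, h⟩, rfl⟩
  · rintro ⟨z, ⟨u, hu, h⟩, rfl⟩
    exact ⟨u + a, by omega, u, z, h, rfl, rfl⟩

/-- At height 0 the truncated `0 - b` is again 0, so the columns met by the translate are those met
by `S`, shifted by `a`. -/
lemma sum_vStep_zero (hS : GoodSet (S : Set (ℕ × ℕ)) m) (hab : (a, b) ∈ S) :
    ∑ x ∈ Finset.range (m + a + b), vStep S (translate S (a, b)) x 0 = a :=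
  sum_shift_eq (m := m) (fun _ hx => hS.vert_of_le hx) (fun _ => vert_add hab)
    (fun x => by rw [vert_translate_iff, Nat.zero_sub]) (fun _ => rfl) (by omega)

/-- Heights `M - b` and `M` both lie past the conductor of `S`, where `Vert` no longer depends on
the height. -/
lemma sum_vStep (hS : GoodSet (S : Set (ℕ × ℕ)) m) (hab : (a, b) ∈ S) :
    ∑ x ∈ Finset.range (m + a + b), vStep S (translate S (a, b)) x (m + a + b) = a :=
  sum_shift_eq (m := m) (fun _ hx => hS.vert_of_le hx) (fun _ => vert_add hab)
    (fun x => by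
      simp only [vert_translate_iff,
        hS.vert_iff_of_le (show m ≤ m + a + b - b by omega) (show _ ≤ m + a + b by omega)])
    (fun _ => rfl) (by omega)

lemma sum_hStep (hS : GoodSet (S : Set (ℕ × ℕ)) m) (hab : (a, b) ∈ S) :
    ∑ y ∈ Finset.range (m + a + b), hStep S (translate S (a, b)) (m + a + b) y = b :=
  sum_shift_eq (m := m) (fun _ hy => hS.horz_of_le hy) (fun _ => horz_add hab)
    (fun y => by
      simp only [horz_translate_iff,
        hS.horz_iff_of_le (show m ≤ m + a + b - a by omega) (show _ ≤ m + a + b by omega)])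
    (fun _ => rfl) (by omega)

lemma dist_zero_right (hS : GoodSet (S : Set (ℕ × ℕ)) m) (hab : (a, b) ∈ S) :
    dist S (translate S (a, b)) (m + a + b) 0 (m + a + b) = a := by
  simpa [dist, Nat.Ico_zero_eq_range] using sum_vStep hS hab

lemma dist_zero_left (hS : GoodSet (S : Set (ℕ × ℕ)) m) (hab : (a, b) ∈ S) :
    dist S (translate S (a, b)) (m + a + b) (m + a + b) 0 = b := by
  simpa [dist, Nat.Ico_zero_eq_range] using sum_hStep hS hab

lemma dist_zero_zero (hS : GoodSet (S : Set (ℕ × ℕ)) m) (hab : (a, b) ∈ S) :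
    dist S (translate S (a, b)) (m + a + b) 0 0 = a + b := by
  simp only [dist, Nat.Ico_zero_eq_range]
  rw [sum_vStep_zero hS hab, sum_hStep hS hab]

lemma numLevels_eq (hS : GoodSet (S : Set (ℕ × ℕ)) m) (hab : (a, b) ∈ S) (hne : (a, b) ≠ 0) :
    numLevels S (a, b) = a + b := by
  have hP := hS.goodPair hab
  have h₀ := dist_zero_zero hS hab
  refine IsLeast.csInf_eq ⟨?_, ?_⟩
  · ext ⟨x, y⟩
    simp only [apery_eq, Set.mem_iUnion, hP.mem_layer_iff, Set.mem_Iio, exists_prop]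
    refine ⟨fun hm => ?_, fun ⟨_, _, hm, _⟩ => hm⟩
    have h₁ := hP.dist_pos hm
    have h₂ := hP.dist_anti x.zero_le y.zero_le
    exact ⟨dist S (translate S (a, b)) (m + a + b) x y - 1, by omega, hm, by omega⟩
  · intro n hn
    -- The origin has the largest distance, `a + b`, so no smaller number of layers reaches it.
    have hm : (0, 0) ∈ apery S (a, b) := by
      refine ⟨S.zero_mem, ?_⟩
      rintro ⟨⟨u, v⟩, -, h⟩
      simp only [Prod.mk_add_mk, Prod.mk.injEq, Nat.add_eq_zero_iff] at h
      exact hne (by simp [h.1.2, h.2.2])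
    rw [Set.mem_ofPred_eq] at hn
    rw [hn] at hm
    simp only [apery_eq, Set.mem_iUnion, hP.mem_layer_iff, Set.mem_Iio, exists_prop] at hm
    obtain ⟨k, hk, -, hd⟩ := hm
    omega

/-! ### Infinite lines and finite layers. -/

lemma verticalLineIn_layer_iff (hS : GoodSet (S : Set (ℕ × ℕ)) m) (hab : (a, b) ∈ S) {k s : ℕ} :
    VerticalLineIn S (a, b) (layer (apery S (a, b)) k) s ↔
      vStep S (translate S (a, b)) s (m + a + b) = 1 ∧
        dist S (translate S (a, b)) (m + a + b) s (m + a + b) = k + 1 := by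
  have hP := hS.goodPair hab
  constructor
  · rintro ⟨-, r, -, -, h⟩
    -- The start `r` may lie below the conductor, so the line is tested at a height past both.
    have hy : m + a + b ≤ r + (m + a + b) + 1 := by omega
    have hm := h (show (s, r + (m + a + b) + 1) ∈ Δ₁ (s, r) from ⟨rfl, by simp only; omega⟩)
    rw [apery_eq, hP.mem_layer_iff] at hm
    rw [hP.vStep_eq_one_iff hy, ← hP.dist_eq_of_le_right hy]
    exact hm
  · rintro ⟨hv, hd⟩
    have hsub : Δ₁ (s, m + a + b) ⊆ layer (apery S (a, b)) k := by
      rintro ⟨x, y⟩ ⟨hx, hy⟩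
      simp only at hx hy
      subst hx
      rw [apery_eq, hP.mem_layer_iff, ← hP.vStep_eq_one_iff hy.le, hP.dist_eq_of_le_right hy.le]
      exact ⟨hv, hd⟩
    refine ⟨⟨_, ((hP.vStep_eq_one_iff le_rfl).1 hv).1, rfl⟩, m + a + b,
      ⟨_, hP.left.cond le_rfl le_rfl, rfl⟩, fun α hα => ?_, hsub⟩
    exact ((hP.mem_layer_iff k α).1 (hsub hα)).1

lemma horizontalLineIn_layer_iff (hS : GoodSet (S : Set (ℕ × ℕ)) m) (hab : (a, b) ∈ S)
    {k s : ℕ} :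
    HorizontalLineIn S (a, b) (layer (apery S (a, b)) k) s ↔
      hStep S (translate S (a, b)) (m + a + b) s = 1 ∧
        dist S (translate S (a, b)) (m + a + b) (m + a + b) s = k + 1 := by
  have hP := hS.goodPair hab
  constructor
  · rintro ⟨-, q, -, -, h⟩
    have hx : m + a + b ≤ q + (m + a + b) + 1 := by omega
    have hm := h (show (q + (m + a + b) + 1, s) ∈ Δ₂ (q, s) from ⟨rfl, by simp only; omega⟩)
    rw [apery_eq, hP.mem_layer_iff] at hm
    rw [hP.hStep_eq_one_iff hx, ← GoodPair.dist_eq_of_le_left hx]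
    exact hm
  · rintro ⟨hv, hd⟩
    have hsub : Δ₂ (m + a + b, s) ⊆ layer (apery S (a, b)) k := by
      rintro ⟨x, y⟩ ⟨hy, hx⟩
      simp only at hx hy
      subst hy
      rw [apery_eq, hP.mem_layer_iff, ← hP.hStep_eq_one_iff hx.le, GoodPair.dist_eq_of_le_left hx.le]
      exact ⟨hv, hd⟩
    refine ⟨⟨_, ((hP.hStep_eq_one_iff le_rfl).1 hv).1, rfl⟩, m + a + b,
      ⟨_, hP.left.cond le_rfl le_rfl, rfl⟩, fun α hα => ?_, hsub⟩
    exact ((hP.mem_layer_iff k α).1 (hsub hα)).1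

lemma existsUnique_verticalLineIn_layer (hS : GoodSet (S : Set (ℕ × ℕ)) m) (hab : (a, b) ∈ S)
    {k : ℕ} (hk : k < a) : ∃! s, VerticalLineIn S (a, b) (layer (apery S (a, b)) k) s := by
  have hP := hS.goodPair hab
  simp only [verticalLineIn_layer_iff hS hab]
  exact existsUnique_jump (fun x => hP.dist_eq_vStep_add x _) (fun x => vStep_le_one _ _ _ _)
    (dist_zero_right hS hab) (GoodPair.dist_eq_zero le_rfl le_rfl) hk

lemma existsUnique_horizontalLineIn_layer (hS : GoodSet (S : Set (ℕ × ℕ)) m) (hab : (a, b) ∈ S)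
    {k : ℕ} (hk : k < b) : ∃! s, HorizontalLineIn S (a, b) (layer (apery S (a, b)) k) s := by
  have hP := hS.goodPair hab
  simp only [horizontalLineIn_layer_iff hS hab]
  exact existsUnique_jump (fun y => hP.dist_eq_hStep_add _ y) (fun y => hStep_le_one _ _ _ _)
    (dist_zero_left hS hab) (GoodPair.dist_eq_zero le_rfl le_rfl) hk

lemma not_exists_verticalLineIn_layer (hS : GoodSet (S : Set (ℕ × ℕ)) m) (hab : (a, b) ∈ S)
    {k : ℕ} (hk : a ≤ k) : ¬ ∃ s, VerticalLineIn S (a, b) (layer (apery S (a, b)) k) s := by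
  rintro ⟨s, hs⟩
  rw [verticalLineIn_layer_iff hS hab] at hs
  have h₁ := (hS.goodPair hab).dist_anti s.zero_le (le_refl (m + a + b))
  have h₂ := dist_zero_right hS hab
  omega

lemma not_exists_horizontalLineIn_layer (hS : GoodSet (S : Set (ℕ × ℕ)) m) (hab : (a, b) ∈ S)
    {k : ℕ} (hk : b ≤ k) : ¬ ∃ s, HorizontalLineIn S (a, b) (layer (apery S (a, b)) k) s := by
  rintro ⟨s, hs⟩
  rw [horizontalLineIn_layer_iff hS hab] at hs
  have h₁ := (hS.goodPair hab).dist_anti (le_refl (m + a + b)) s.zero_le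
  have h₂ := dist_zero_left hS hab
  omega

/-- Outside the square of side `M` the distance is at most `b` (to the right) or `a` (above), hence
never `k + 1`. -/
lemma finite_layer (hS : GoodSet (S : Set (ℕ × ℕ)) m) (hab : (a, b) ∈ S) {k : ℕ} (ha : a ≤ k)
    (hb : b ≤ k) : (layer (apery S (a, b)) k).Finite := by
  have hP := hS.goodPair hab
  refine ((Set.finite_Iio (m + a + b)).prod (Set.finite_Iio (m + a + b))).subset ?_
  rintro ⟨x, y⟩ hm
  rw [apery_eq, hP.mem_layer_iff] at hm
  obtain ⟨-, hd⟩ := hm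
  simp only at hd
  by_contra hc
  simp only [Set.mem_prod, Set.mem_Iio, not_and_or, not_lt] at hc
  rcases hc with hx | hy
  · have h₁ := hP.dist_anti hx y.zero_le
    rw [dist_zero_left hS hab] at h₁
    omega
  · have h₁ := hP.dist_anti x.zero_le hy
    rw [dist_zero_right hS hab] at h₁
    omega

end Translate

end GoodSemigroup

theorem theorem3p8 (S : AddSubmonoid (ℕ × ℕ)) (hS : GoodSemigroup.IsGood S)
    (hloc : GoodSemigroup.IsLocal S) (e₁ e₂ : ℕ)
    (he : GoodSemigroup.IsMinNonzero S (e₁, e₂)) (e : ℕ) (he_sum : e = e₁ + e₂)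
    (A : ℕ → Set (ℕ × ℕ)) (hA : A = GoodSemigroup.level S (e₁, e₂)) :
    GoodSemigroup.numLevels S (e₁, e₂) = e ∧
    GoodSemigroup.apery S (e₁, e₂) = ⋃ i ∈ Set.Icc 1 e, A i ∧
    (e₂ ≤ e₁ →
      (∀ i ∈ Set.Icc (e - e₂ + 1) e, GoodSemigroup.HasTwoLines S (e₁, e₂) (A i)) ∧
      (∀ i ∈ Set.Icc (e - e₁ + 1) (e - e₂),
        GoodSemigroup.HasOnlyVerticalLine S (e₁, e₂) (A i)) ∧
      (∀ i ∈ Set.Icc 1 (e - e₁), (A i).Finite)) ∧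
    (e₁ ≤ e₂ →
      (∀ i ∈ Set.Icc (e - e₁ + 1) e, GoodSemigroup.HasTwoLines S (e₁, e₂) (A i)) ∧
      (∀ i ∈ Set.Icc (e - e₂ + 1) (e - e₁),
        GoodSemigroup.HasOnlyHorizontalLine S (e₁, e₂) (A i)) ∧
      (∀ i ∈ Set.Icc 1 (e - e₂), (A i).Finite)) := by
  obtain ⟨m, hm⟩ := hS.exists_goodSet
  have hmem : (e₁, e₂) ∈ S := he.1.1
  have hN := GoodSemigroup.numLevels_eq hm hmem he.1.2
  rw [← he_sum] at hN
  have hAi : ∀ i, A i = GoodSemigroup.layer (GoodSemigroup.apery S (e₁, e₂)) (e - i) := fun i => by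
    rw [hA, GoodSemigroup.level, hN]
  have vert : ∀ i, e - i < e₁ → ∃! s, GoodSemigroup.VerticalLineIn S (e₁, e₂) (A i) s :=
    fun i hi => hAi i ▸ GoodSemigroup.existsUnique_verticalLineIn_layer hm hmem hi
  have horz : ∀ i, e - i < e₂ → ∃! s, GoodSemigroup.HorizontalLineIn S (e₁, e₂) (A i) s :=
    fun i hi => hAi i ▸ GoodSemigroup.existsUnique_horizontalLineIn_layer hm hmem hi
  have not_vert : ∀ i, e₁ ≤ e - i → ¬ ∃ s, GoodSemigroup.VerticalLineIn S (e₁, e₂) (A i) s :=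
    fun i hi => hAi i ▸ GoodSemigroup.not_exists_verticalLineIn_layer hm hmem hi
  have not_horz : ∀ i, e₂ ≤ e - i → ¬ ∃ s, GoodSemigroup.HorizontalLineIn S (e₁, e₂) (A i) s :=
    fun i hi => hAi i ▸ GoodSemigroup.not_exists_horizontalLineIn_layer hm hmem hi
  have fin : ∀ i, e₁ ≤ e - i → e₂ ≤ e - i → (A i).Finite :=
    fun i h₁ h₂ => hAi i ▸ GoodSemigroup.finite_layer hm hmem h₁ h₂
  refine ⟨hN, ?_, fun hle => ⟨?_, ?_, ?_⟩, fun hle => ⟨?_, ?_, ?_⟩⟩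
  · have hpos : GoodSemigroup.apery S (e₁, e₂) =
        ⋃ k ∈ Set.Iio e, GoodSemigroup.layer (GoodSemigroup.apery S (e₁, e₂)) k := by
      rw [← hN]
      refine Nat.sInf_mem (s := {N : ℕ | GoodSemigroup.apery S (e₁, e₂) =
        ⋃ k ∈ Set.Iio N, GoodSemigroup.layer (GoodSemigroup.apery S (e₁, e₂)) k})
        (Nat.nonempty_of_pos_sInf ?_)
      -- Since `sInf ∅ = 0`, a positive infimum shows that finitely many layers do exhaust the Apéry
      -- set.
      have hpos' : 0 < e₁ + e₂ := by
        by_contra h₀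
        exact he.1.2 (by rw [Prod.mk_eq_zero]; omega)
      have : 0 < GoodSemigroup.numLevels S (e₁, e₂) := by omega
      exact this
    refine hpos.trans ?_
    ext α
    simp only [Set.mem_iUnion, Set.mem_Iio, Set.mem_Icc, exists_prop, hAi]
    constructor
    · rintro ⟨k, hk, hα⟩
      exact ⟨e - k, by omega, by rwa [Nat.sub_sub_self hk.le]⟩
    · rintro ⟨i, hi, hα⟩
      exact ⟨e - i, by omega, hα⟩
  all_goals
    rintro i ⟨h₁, h₂⟩
  · exact ⟨vert i (by omega), horz i (by omega)⟩
  · exact ⟨vert i (by omega), not_horz i (by omega)⟩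
  · exact fin i (by omega) (by omega)
  · exact ⟨vert i (by omega), horz i (by omega)⟩
  · exact ⟨horz i (by omega), not_vert i (by omega)⟩
  · exact fin i (by omega) (by omega)
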